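/- Let $L$ be a first-order language with equality $=$, propositional constants $\mathrm{true},\mathrm{false}$, a denumerable set of variables, arbitrary (possibly infinite) sets of function and predicate symbols, and at least one constant. A *query* is a formula built from $\mathrm{true}$, $\mathrm{false}$, equations $s=t$ and atoms $p(s_1,\dots,s_n)$ using $\wedge$ and $\exists$; $|Q|$ denotes the number of occurrences of atoms in $Q$. A *pre-interpretation* $J$ of $L$ is a non-empty set $U$ with an interpretation of the function symbols on it; equality is interpreted as identity. A *valuation* $h$ is a map from the variables to $U$, extended to terms. An *interpretation based on* $J$ is a set of generalized atoms $p(d_1,\dots,d_n)$, $d_i\in U$ (those that are true). $J$ is a model of the *free equality axioms* $\mathrm{FEA}_L$ if every function symbol is interpreted by an injective map, distinct function symbols have disjoint ranges, and $h(x)\neq h(t)$ for every valuation $h$, variable $x$ and term $t\not\equiv x$ in which $x$ occurs. A query is *consistent* if it is true in some interpretation based on some model $J$ of $\mathrm{FEA}_L$, under some valuation. For a finite sequence $\bar I$ of $|Q|$ interpretations based on $J$, the solution set $[Q]_J(\bar I)$ is the set of valuations defined by: $[\mathrm{true}]_J(\varepsilon)$ consists of all valuations and $[\mathrm{false}]_J(\varepsilon)=\emptyset$,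 where $\varepsilon$ is the empty sequence; $[s=t]_J(\varepsilon)=\{h: h(s)=h(t)\}$; $[A]_J(I)=\{h: h(A)\in I\}$ for an atom $A$; $[Q_1\wedge Q_2]_J(\bar I_1\bar I_2)=[Q_1]_J(\bar I_1)\cap[Q_2]_J(\bar I_2)$ where $|\bar I_i|=|Q_i|$; $[(\exists x)Q]_J(\bar I)=\{h: h[x\mapsto d]\in[Q]_J(\bar I)\text{ for some }d\in U\}$. Write $Q\preceq Q'$ ("$Q'$ is a generalization of $Q$") if for every model $J$ of $\mathrm{FEA}_L$ one has $|Q|=|Q'|$ and $[Q]_J(\bar I)\subseteq[Q']_J(\bar I)$ for all $\bar I$ of length $|Q|$; $Q\approx Q'$ if $Q\preceq Q'$ and $Q'\preceq Q$; and $Q\prec Q'$ if $Q\preceq Q'$ but not $Q'\preceq Q$. Then: 1. for every consistent query $Q$, the set of generalizations $\{Q' : Q\preceq Q'\}$ consists of only finitely many $\approx$-classes; 2. there is no infinite sequence of queries $Q_0\prec Q_1\prec Q_2\prec\cdots$. -/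

import Mathlib

universe u v w

namespace ConjQuery

/-- A pre-interpretation: a non-empty domain with an interpretation of the function symbols. -/
structure PreInterpretation (L : FirstOrder.Language.{u, v}) where
  Carrier : Type w
  nonempty : Nonempty Carrier
  fn : {n : ℕ} → L.Functions n → (Fin n → Carrier) → Carrier

namespace PreInterpretation

variable {L : FirstOrder.Language.{u, v}} (J : PreInterpretation.{u, v, w} L)

/-- Valuations over `J`; the variables are the natural numbers. -/
abbrev Valuation : Type w := ℕ → J.Carrier

/-- The homomorphic extension of a valuation to all terms. -/
def eval (h : J.Valuation) : L.Term ℕ → J.Carrier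
  | .var x => h x
  | .func f ts => J.fn f (fun i => eval h (ts i))

/-- The `J`-base: generalized atoms `p(d₁, …, dₙ)` with `dᵢ` in the domain of `J`. -/
abbrev Base : Type (max v w) := Σ n : ℕ, L.Relations n × (Fin n → J.Carrier)

/-- An interpretation based on `J`, identified with a subset of the `J`-base. -/
abbrev Interpretation : Type (max v w) := Set J.Base

/-- `J` is a model of the free equality axioms of `L`. Each field says that the axioms of one
of the three groups are true in `J` under all valuations. -/
structure ModelsFEA : Prop where
  injective : ∀ {n : ℕ} (f : L.Functions n) (x y : Fin n → J.Carrier),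
    J.fn f x = J.fn f y ↔ ∀ i, x i = y i
  disjoint : ∀ {n m : ℕ} (f : L.Functions n) (g : L.Functions m),
    (⟨n, f⟩ : Σ k, L.Functions k) ≠ ⟨m, g⟩ →
      ∀ (x : Fin n → J.Carrier) (y : Fin m → J.Carrier), J.fn f x ≠ J.fn g y
  acyclic : ∀ (x : ℕ) (t : L.Term ℕ), t ≠ FirstOrder.Language.Term.var x → x ∈ t.varFinset →
    ∀ h : J.Valuation, h x ≠ J.eval h t

end PreInterpretation

/-- Queries, i.e. positive conjunctive queries: formulas built from the propositional
constants, equations and atoms by conjunction and existential quantification. -/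
inductive Query (L : FirstOrder.Language.{u, v}) : Type (max u v)
  | tru : Query L
  | fls : Query L
  | eq (s t : L.Term ℕ) : Query L
  | atom {n : ℕ} (p : L.Relations n) (ts : Fin n → L.Term ℕ) : Query L
  | and (Q₁ Q₂ : Query L) : Query L
  | ex (x : ℕ) (Q : Query L) : Query L

namespace Query

variable {L : FirstOrder.Language.{u, v}}

/-- The number `|Q|` of occurrences of atoms in `Q`. -/
def card : Query L → ℕ
  | tru => 0
  | fls => 0
  | eq _ _ => 0
  | atom _ _ => 1
  | and Q₁ Q₂ => Q₁.card + Q₂.card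
  | ex _ Q => Q.card

/-- Ordinary truth of a query in an interpretation `I` based on `J`, under a valuation. -/
def Holds (J : PreInterpretation.{u, v, w} L) (I : J.Interpretation) :
    Query L → J.Valuation → Prop
  | tru, _ => True
  | fls, _ => False
  | eq s t, h => J.eval h s = J.eval h t
  | atom p ts, h => (⟨_, p, fun i => J.eval h (ts i)⟩ : J.Base) ∈ I
  | and Q₁ Q₂, h => Holds J I Q₁ h ∧ Holds J I Q₂ h
  | ex x Q, h => ∃ d : J.Carrier, Holds J I Q (Function.update h x d)

/-- The set of solutions of `Q` in a multiinterpretation (a finite sequence of interpretations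
based on `J`, one for each occurrence of an atom). Only meaningful when the length of the
sequence is `Q.card`. -/
def msol (J : PreInterpretation.{u, v, w} L) :
    Query L → List J.Interpretation → Set J.Valuation
  | tru, _ => Set.univ
  | fls, _ => ∅
  | eq s t, _ => {h | J.eval h s = J.eval h t}
  | atom p ts, Is =>
      {h | ∃ I, Is = [I] ∧ (⟨_, p, fun i => J.eval h (ts i)⟩ : J.Base) ∈ I}
  | and Q₁ Q₂, Is => msol J Q₁ (Is.take Q₁.card) ∩ msol J Q₂ (Is.drop Q₁.card)
  | ex x Q, Is => {h | ∃ d : J.Carrier, Function.update h x d ∈ msol J Q Is}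

/-- The preorder `Q ⪯_J Q'`. -/
def LeIn (J : PreInterpretation.{u, v, w} L) (Q Q' : Query L) : Prop :=
  Q.card = Q'.card ∧
    ∀ Is : List J.Interpretation, Is.length = Q.card → Q.msol J Is ⊆ Q'.msol J Is

/-- `Q ⪯ Q'`: the query `Q'` is more general than `Q` (a generalization of `Q`). -/
def Le (Q Q' : Query L) : Prop :=
  ∀ J : PreInterpretation.{u, v, w} L, J.ModelsFEA → LeIn J Q Q'

/-- `Q ≺ Q'`. -/
def Lt (Q Q' : Query L) : Prop :=
  Le.{u, v, w} Q Q' ∧ ¬ Le.{u, v, w} Q' Q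

/-- `Q ≈ Q'`. -/
def Equivalent (Q Q' : Query L) : Prop :=
  Le.{u, v, w} Q Q' ∧ Le.{u, v, w} Q' Q

/-- `Q` is true in some model of the free equality axioms, under some valuation. -/
def Consistent (Q : Query L) : Prop :=
  ∃ J : PreInterpretation.{u, v, w} L, J.ModelsFEA ∧
    ∃ (I : J.Interpretation) (h : J.Valuation), Q.Holds J I h

theorem Le.refl (Q : Query L) : Le.{u, v, w} Q Q :=
  fun _ _ => ⟨rfl, fun _ _ => subset_rfl⟩

theorem Le.trans {Q₁ Q₂ Q₃ : Query L} (h₁ : Le.{u, v, w} Q₁ Q₂) (h₂ : Le.{u, v, w} Q₂ Q₃) :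
    Le.{u, v, w} Q₁ Q₃ :=
  fun J hJ => ⟨(h₁ J hJ).1.trans (h₂ J hJ).1, fun Is hl =>
    ((h₁ J hJ).2 Is hl).trans ((h₂ J hJ).2 Is (hl.trans (h₁ J hJ).1))⟩

/-- Equivalence of queries as a setoid. -/
def equivalentSetoid (L : FirstOrder.Language.{u, v}) : Setoid (Query L) where
  r := Equivalent.{u, v, w}
  iseqv := ⟨fun Q => ⟨Le.refl Q, Le.refl Q⟩, fun h => ⟨h.2, h.1⟩,
    fun h₁ h₂ => ⟨h₁.1.trans h₂.1, h₂.2.trans h₁.2⟩⟩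

/-- The set of `≈`-classes of the generalizations of `Q`. -/
def generalizationClasses (Q : Query L) : Set (Quotient (equivalentSetoid.{u, v, w} L)) :=
  Quotient.mk (equivalentSetoid.{u, v, w} L) '' {Q' | Le.{u, v, w} Q Q'}

end Query

end ConjQuery

/-! Replace each atom occurrence by equations tying its arguments to fresh variables, its argument
places. A query then becomes its list of predicate symbols together with a positive primitive
condition `Rel` on families indexed by variables and places. Feeding in one-atom interpretations
shows that, above a query with a solution, `Le` means equal predicate lists and inclusion of `Rel`
(`Le.preds_eq_and_rel`, `le_of_rel`). Such conditions are preserved by homomorphisms and products.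

A query is then described by the tests that all its solutions pass: two constituents coincide, or a
constituent has a given outermost symbol. Suppose `Q'` has a solution in a well-founded model that
passes only finitely many nontrivial tests. Multiplying by one counter-model for each passed test
not forced by `Q'` gives a generic solution, passing exactly the forced tests. If all these tests
are forced by `Q` too, the generic solution maps homomorphically onto any solution of `Q`, which
therefore solves `Q'` (`le_of_tests_subset`). So tests determine the class.

A consistent `Q` has such a solution `s` in a term model. Every generalization of `Q` is also solved
by `s`, so its nontrivial tests form a subset of one finite set: finitely many classes. A strictly
increasing chain is consistent from its second member on, so it would repeat a class. -/

namespace ConjQuery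

open FirstOrder Function

/-! ### Constituents and acyclicity -/

namespace PreInterpretation

variable {L : FirstOrder.Language.{u, v}}

/-- `c` is an immediate constituent of `d`. -/
def Child (J : PreInterpretation.{u, v, w} L) (c d : J.Carrier) : Prop :=
  ∃ (n : ℕ) (f : L.Functions n) (x : Fin n → J.Carrier) (i : Fin n), J.fn f x = d ∧ x i = c

theorem eval_relabel (J : PreInterpretation.{u, v, w} L) (h : J.Valuation) (g : ℕ → ℕ)
    (t : L.Term ℕ) : J.eval h (t.relabel g) = J.eval (h ∘ g) t := by
  induction t with
  | var x => rfl
  | func f ts ih => exact congrArg (J.fn f) (funext ih)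

theorem eval_congr (J : PreInterpretation.{u, v, w} L) {h h' : J.Valuation} (t : L.Term ℕ)
    (H : ∀ x ∈ t.varFinset, h x = h' x) : J.eval h t = J.eval h' t := by
  induction t with
  | var x => exact H x (by simp [Language.Term.varFinset])
  | func f ts ih =>
    refine congrArg (J.fn f) (funext fun i => ih i fun x hx => H x ?_)
    simp only [Language.Term.varFinset, Finset.mem_biUnion, Finset.mem_univ, true_and]
    exact ⟨i, hx⟩

theorem transGen_child_eval (J : PreInterpretation.{u, v, w} L) (h : J.Valuation) (x : ℕ)
    (t : L.Term ℕ) (hx : x ∈ t.varFinset) :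
    t = Language.Term.var x ∨ Relation.TransGen J.Child (h x) (J.eval h t) := by
  induction t with
  | var y =>
    left
    simp only [Language.Term.varFinset, Finset.mem_singleton] at hx
    rw [hx]
  | func f ts ih =>
    right
    simp only [Language.Term.varFinset, Finset.mem_biUnion, Finset.mem_univ, true_and] at hx
    obtain ⟨i, hi⟩ := hx
    have hc : J.Child (J.eval h (ts i)) (J.eval h (Language.Term.func f ts)) :=
      ⟨_, f, fun i => J.eval h (ts i), i, rfl, rfl⟩
    rcases ih i hi with e | e
    · rw [e] at hc
      exact .single hc
    · exact e.tail hc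

/-- Turns the acyclicity axioms, which speak of terms, into a statement about chains of
constituents: the term records the chain, with new variables for the sibling arguments. -/
theorem exists_term_of_transGen {J : PreInterpretation.{u, v, w} L} {c d : J.Carrier} (h : Relation.TransGen J.Child c d) :
    ∃ (k : J.Valuation) (t : L.Term ℕ), k 0 = c ∧ 0 ∈ t.varFinset ∧
      t ≠ Language.Term.var 0 ∧ J.eval k t = d := by
  have step : ∀ (k : J.Valuation) (t : L.Term ℕ) (d d' : J.Carrier), k 0 = c → 0 ∈ t.varFinset →
      J.eval k t = d → J.Child d d' →
      ∃ (k : J.Valuation) (t : L.Term ℕ), k 0 = c ∧ 0 ∈ t.varFinset ∧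
        t ≠ Language.Term.var 0 ∧ J.eval k t = d' := by
    rintro k t d d' hk ht hd ⟨n, f, x, i, rfl, rfl⟩
    -- Even variables carry the old valuation, odd ones the arguments of `f`; variable `0` keeps its
    -- value.
    let k' : J.Valuation := fun a => if a % 2 = 0 then k (a / 2) else
      if hlt : a / 2 < n then x ⟨a / 2, hlt⟩ else k 0
    let ts : Fin n → L.Term ℕ := fun j =>
      if j = i then t.relabel (fun a => 2 * a) else Language.Term.var (2 * (j : ℕ) + 1)
    refine ⟨k', Language.Term.func f ts, by simpa [k'] using hk, ?_, by simp, ?_⟩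
    · simp only [Language.Term.varFinset, Finset.mem_biUnion, Finset.mem_univ, true_and]
      refine ⟨i, ?_⟩
      have : ∀ t : L.Term ℕ, 0 ∈ t.varFinset → 0 ∈ (t.relabel (fun a => 2 * a)).varFinset := by
        intro t
        induction t with
        | var a => simp [Language.Term.varFinset, Language.Term.relabel, eq_comm]
        | func g us ih =>
          simp only [Language.Term.relabel, Language.Term.varFinset, Finset.mem_biUnion,
            Finset.mem_univ, true_and]
          rintro ⟨j, hj⟩
          exact ⟨j, ih j hj⟩
      simpa [ts] using this t ht
    · refine congrArg (J.fn f) (funext fun j => ?_)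
      by_cases hj : j = i
      · subst hj
        have : k' ∘ (fun a => 2 * a) = k := by
          funext a
          simp [k']
        simp [ts, eval_relabel, this, hd]
      · have h1 : (2 * (j : ℕ) + 1) % 2 = 1 := by omega
        have h2 : (2 * (j : ℕ) + 1) / 2 = j := by omega
        simp [ts, hj, eval, k', h1, h2]
  induction h with
  | single h =>
    exact step (fun _ => c) (Language.Term.var 0) c _ rfl
      (by simp [Language.Term.varFinset]) rfl h
  | tail _ h ih =>
    obtain ⟨k, t, h1, h2, -, h3⟩ := ih
    exact step k t _ _ h1 h2 h3 h

theorem ModelsFEA.of_wellFounded {J : PreInterpretation.{u, v, w} L}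
    (hi : ∀ {n : ℕ} (f : L.Functions n) (x y : Fin n → J.Carrier), J.fn f x = J.fn f y → x = y)
    (hd : ∀ {n m : ℕ} (f : L.Functions n) (g : L.Functions m)
      (x : Fin n → J.Carrier) (y : Fin m → J.Carrier), J.fn f x = J.fn g y →
        (⟨n, f⟩ : Σ k, L.Functions k) = ⟨m, g⟩)
    (hw : WellFounded J.Child) : J.ModelsFEA where
  injective f x y := ⟨fun h => congrFun (hi f x y h), fun h => congrArg _ (funext h)⟩
  disjoint f g hne x y h := hne (hd f g x y h)
  acyclic x t hne hx h he := by
    rcases J.transGen_child_eval h x t hx with e | e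
    · exact hne e
    · rw [he] at e
      exact hw.transGen.irrefl.irrefl _ e

namespace ModelsFEA

variable {J : PreInterpretation.{u, v, w} L} (hJ : J.ModelsFEA)
include hJ

theorem fn_inj {n : ℕ} {f : L.Functions n} {x y : Fin n → J.Carrier} (h : J.fn f x = J.fn f y) :
    x = y :=
  funext ((hJ.injective f x y).1 h)

theorem fn_eq {n m : ℕ} {f : L.Functions n} {g : L.Functions m}
    {x : Fin n → J.Carrier} {y : Fin m → J.Carrier} (h : J.fn f x = J.fn g y) :
    (⟨n, f⟩ : Σ k, L.Functions k) = ⟨m, g⟩ :=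
  by_contra fun hne => hJ.disjoint f g hne x y h

theorem fn_cases {n m : ℕ} {f : L.Functions n} {g : L.Functions m}
    {x : Fin n → J.Carrier} {y : Fin m → J.Carrier} (h : J.fn f x = J.fn g y) :
    ∃ e : n = m, e ▸ f = g ∧ e ▸ x = y := by
  have h1 := hJ.fn_eq h
  cases h1
  exact ⟨rfl, rfl, hJ.fn_inj h⟩

theorem not_transGen_child_self (c : J.Carrier) : ¬ Relation.TransGen J.Child c c := by
  intro h
  obtain ⟨k, t, h1, h2, h3, h4⟩ := exists_term_of_transGen h
  exact hJ.acyclic 0 t h3 h2 k (h1.trans h4.symm)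

/-- Constituency has no cycles, and a strict order on a finite set is well-founded. The whole model
may have infinite descending chains. -/
theorem wellFounded_child_inter {V : Set J.Carrier} (hV : V.Finite) :
    WellFounded fun c d => c ∈ V ∧ d ∈ V ∧ J.Child c d := by
  have : IsStrictOrder J.Carrier (Relation.TransGen J.Child) :=
    { irrefl := hJ.not_transGen_child_self, trans := fun _ _ _ => Relation.TransGen.trans }
  have := (hV.wellFoundedOn (r := Relation.TransGen J.Child))
  rw [Set.wellFoundedOn_iff] at this
  exact Subrelation.wf (fun ⟨h1, h2, h3⟩ => ⟨.single h3, h1, h2⟩) this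

end ModelsFEA

/-! ### Partial homomorphisms -/

/-- `ρ` commutes with the function symbols as long as all the elements involved are in `V`. -/
def CommutesOn (J J' : PreInterpretation.{u, v, w} L) (V : Set J.Carrier)
    (ρ : J.Carrier → J'.Carrier) : Prop :=
  ∀ {n : ℕ} (f : L.Functions n) (x : Fin n → J.Carrier), J.fn f x ∈ V → (∀ i, x i ∈ V) →
    ρ (J.fn f x) = J'.fn f (ρ ∘ x)

theorem CommutesOn.mono {J J' : PreInterpretation.{u, v, w} L} {V V' : Set J.Carrier}
    {ρ : J.Carrier → J'.Carrier} (h : CommutesOn J J' V' ρ) (hV : V ⊆ V') :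
    CommutesOn J J' V ρ :=
  fun f x hx hy => h f x (hV hx) fun i => hV (hy i)

/-- Recursion on constituents: decompositions are unique under the free equality axioms, so the
value at `J.fn f x` is forced by the values at the arguments, and `α` is free to prescribe the
indecomposable elements. -/
theorem ModelsFEA.exists_commutesOn {J : PreInterpretation.{u, v, w} L} (hJ : J.ModelsFEA)
    (J' : PreInterpretation.{u, v, w} L) {V : Set J.Carrier}
    (hV : WellFounded fun c d => c ∈ V ∧ d ∈ V ∧ J.Child c d) (α : J.Carrier → J'.Carrier) :
    ∃ ρ : J.Carrier → J'.Carrier, CommutesOn J J' V ρ ∧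
      ∀ d, (∀ (n : ℕ) (f : L.Functions n) (x : Fin n → J.Carrier), J.fn f x ≠ d) → ρ d = α d := by
  classical
  let R : J.Carrier → J.Carrier → Prop := fun c d => c ∈ V ∧ d ∈ V ∧ J.Child c d
  let Dec : J.Carrier → (Σ n, L.Functions n × (Fin n → J.Carrier)) → Prop := fun d z =>
    J.fn z.2.1 z.2.2 = d ∧ d ∈ V ∧ ∀ i, z.2.2 i ∈ V
  have hR : ∀ d z, Dec d z → ∀ i, R (z.2.2 i) d := fun d z hz i =>
    ⟨hz.2.2 i, hz.2.1, ⟨_, z.2.1, z.2.2, i, hz.1, rfl⟩⟩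
  let F : ∀ d, (∀ c, R c d → J'.Carrier) → J'.Carrier := fun d ih =>
    if hd : ∃ z, Dec d z then
      J'.fn hd.choose.2.1 fun i => ih (hd.choose.2.2 i) (hR d _ hd.choose_spec i)
    else α d
  refine ⟨hV.fix F, ?_, ?_⟩
  · intro n f x hf hx
    have hd : ∃ z, Dec (J.fn f x) z := ⟨⟨n, f, x⟩, rfl, hf, hx⟩
    rw [hV.fix_eq]
    have e : F (J.fn f x) (fun c _ => hV.fix F c) =
        J'.fn hd.choose.2.1 fun i => hV.fix F (hd.choose.2.2 i) := dif_pos hd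
    refine e.trans ?_
    have hc := hd.choose_spec.1
    generalize hd.choose = z at hc
    obtain ⟨m, g, y⟩ := z
    obtain ⟨e1, e2, e3⟩ := hJ.fn_cases hc
    cases e1
    cases e2
    cases e3
    rfl
  · intro d hd
    rw [hV.fix_eq]
    exact dif_neg fun ⟨z, hz⟩ => hd _ _ _ hz.1

/-! ### Products and term models -/

/-- The product of two pre-interpretations. -/
def prod (J₁ J₂ : PreInterpretation.{u, v, w} L) : PreInterpretation.{u, v, w} L where
  Carrier := J₁.Carrier × J₂.Carrier
  nonempty := haveI := J₁.nonempty; haveI := J₂.nonempty; inferInstance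
  fn f x := (J₁.fn f fun i => (x i).1, J₂.fn f fun i => (x i).2)

theorem eval_prod (J₁ J₂ : PreInterpretation.{u, v, w} L) (h : (J₁.prod J₂).Valuation)
    (t : L.Term ℕ) : (J₁.prod J₂).eval h t =
      (J₁.eval (fun x => (h x).1) t, J₂.eval (fun x => (h x).2) t) := by
  induction t with
  | var x => rfl
  | func f ts ih =>
    refine Prod.ext (congrArg (J₁.fn f) (funext fun i => ?_))
      (congrArg (J₂.fn f) (funext fun i => ?_))
    · exact congrArg Prod.fst (ih i)
    · exact congrArg Prod.snd (ih i)

/-- A descending chain projects to the first factor, so the second factor may be arbitrary. -/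
theorem wellFounded_child_prod {J₁ : PreInterpretation.{u, v, w} L}
    (J₂ : PreInterpretation.{u, v, w} L) (hw : WellFounded J₁.Child) :
    WellFounded (J₁.prod J₂).Child := by
  refine Subrelation.wf ?_ (InvImage.wf (Prod.fst : J₁.Carrier × J₂.Carrier → J₁.Carrier) hw)
  rintro c d ⟨n, f, x, i, rfl, rfl⟩
  exact ⟨n, f, fun i => (x i).1, i, rfl, rfl⟩

theorem ModelsFEA.prod {J₁ J₂ : PreInterpretation.{u, v, w} L} (h₁ : J₁.ModelsFEA)
    (h₂ : J₂.ModelsFEA) : (J₁.prod J₂).ModelsFEA where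
  injective f x y := by
    refine ⟨fun h i => ?_, fun h => congrArg _ (funext h)⟩
    have e1 := h₁.fn_inj (congrArg Prod.fst h)
    have e2 := h₂.fn_inj (congrArg Prod.snd h)
    exact Prod.ext (congrFun e1 i) (congrFun e2 i)
  disjoint f g hne x y h := h₁.disjoint f g hne _ _ (congrArg Prod.fst h)
  acyclic x t hne hx h he := by
    rw [eval_prod] at he
    exact h₁.acyclic x t hne hx (fun x => (h x).1) (congrArg Prod.fst he)

/-- The language whose function symbols of every arity are the elements of `α`. -/
def nameLanguage (α : Type w) : FirstOrder.Language.{w, 0} := ⟨fun _ => α, fun _ => Empty⟩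

/-- The term model over the variables `ι`, where a function symbol is represented by its value
on a constant tuple of `J`, so that the universe of the carrier is that of `J`. -/
def termModel (J : PreInterpretation.{u, v, w} L) (d : J.Carrier) (ι : Type) [Nonempty ι] :
    PreInterpretation.{u, v, w} L where
  Carrier := (nameLanguage J.Carrier).Term ι
  nonempty := ⟨Language.Term.var (Classical.arbitrary ι)⟩
  fn {_} f x := Language.Term.func (L := nameLanguage J.Carrier) (J.fn f fun _ => d) x

theorem wellFounded_child_termModel (J : PreInterpretation.{u, v, w} L) (d : J.Carrier)
    (ι : Type) [Nonempty ι] : WellFounded (J.termModel d ι).Child := by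
  refine ⟨fun (t : (nameLanguage J.Carrier).Term ι) => ?_⟩
  induction t with
  | var x =>
    refine ⟨_, ?_⟩
    rintro c ⟨n, f, y, i, h, -⟩
    cases h
  | @func l g ts ih =>
    refine ⟨_, ?_⟩
    rintro c ⟨n, f, y, i, h, rfl⟩
    cases h
    exact ih i

theorem ModelsFEA.termModel {J : PreInterpretation.{u, v, w} L} (hJ : J.ModelsFEA)
    (d : J.Carrier) (ι : Type) [Nonempty ι] : (J.termModel d ι).ModelsFEA := by
  refine .of_wellFounded ?_ ?_ (J.wellFounded_child_termModel d ι)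
  · intro n f x y h
    exact eq_of_heq (Language.Term.func.inj h).2.2
  · intro n m f g x y h
    obtain ⟨h1, h2, -⟩ := Language.Term.func.inj h
    cases h1
    exact hJ.fn_eq (eq_of_heq h2)

theorem termModel_fn_ne_var (J : PreInterpretation.{u, v, w} L) (d : J.Carrier)
    (ι : Type) [Nonempty ι] (i : ι) {n : ℕ} (f : L.Functions n)
    (x : Fin n → (J.termModel d ι).Carrier) :
    (J.termModel d ι).fn f x ≠ Language.Term.var i :=
  fun h => by cases h

/-! ### Paths to constituents -/

/-- `J.At d p e`: following the path `p`, read from right to left, leads from `d` to its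
constituent `e`. -/
inductive At (J : PreInterpretation.{u, v, w} L) (d : J.Carrier) :
    List (Σ n, L.Functions n × Fin n) → J.Carrier → Prop
  | nil : At J d [] d
  | cons {p : List (Σ n, L.Functions n × Fin n)} {n : ℕ} (f : L.Functions n)
      (x : Fin n → J.Carrier) (i : Fin n) (h : At J d p (J.fn f x)) :
      At J d (⟨n, f, i⟩ :: p) (x i)

theorem At.unique {J : PreInterpretation.{u, v, w} L} (hJ : J.ModelsFEA) {d e e' : J.Carrier}
    {p : List (Σ n, L.Functions n × Fin n)} (h : J.At d p e) (h' : J.At d p e') : e = e' := by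
  induction h generalizing e' with
  | nil => cases h'; rfl
  | cons f x i h ih =>
    cases h' with
    | cons _ y _ h' => exact congrFun (hJ.fn_inj (ih h')) i

theorem At.fst {J₁ J₂ : PreInterpretation.{u, v, w} L} {d e : (J₁.prod J₂).Carrier}
    {p : List (Σ n, L.Functions n × Fin n)} (h : (J₁.prod J₂).At d p e) :
    J₁.At d.1 p e.1 := by
  induction h with
  | nil => exact .nil
  | cons f x i h ih => exact .cons f (fun i => (x i).1) i ih

theorem At.snd {J₁ J₂ : PreInterpretation.{u, v, w} L} {d e : (J₁.prod J₂).Carrier}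
    {p : List (Σ n, L.Functions n × Fin n)} (h : (J₁.prod J₂).At d p e) :
    J₂.At d.2 p e.2 := by
  induction h with
  | nil => exact .nil
  | cons f x i h ih => exact .cons f (fun i => (x i).2) i ih

theorem At.eq_nil {J : PreInterpretation.{u, v, w} L} {d e : J.Carrier}
    {p : List (Σ n, L.Functions n × Fin n)} (h : J.At d p e)
    (hd : ∀ (n : ℕ) (f : L.Functions n) (x : Fin n → J.Carrier), J.fn f x ≠ d) :
    p = [] ∧ e = d := by
  induction h with
  | nil => exact ⟨rfl, rfl⟩
  | cons f x i h ih => exact absurd ih.2 (hd _ f x)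

theorem At.fn_cases {J : PreInterpretation.{u, v, w} L} (hJ : J.ModelsFEA) {n : ℕ}
    {f : L.Functions n} {y : Fin n → J.Carrier} {e : J.Carrier}
    {p : List (Σ n, L.Functions n × Fin n)} (h : J.At (J.fn f y) p e) :
    (p = [] ∧ e = J.fn f y) ∨ ∃ i p', p = p' ++ [⟨n, f, i⟩] ∧ J.At (y i) p' e := by
  induction h with
  | nil => exact .inl ⟨rfl, rfl⟩
  | cons g x i h ih =>
    right
    rcases ih with ⟨rfl, e⟩ | ⟨j, p', rfl, h'⟩
    · obtain ⟨e1, e2, e3⟩ := hJ.fn_cases e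
      cases e1
      cases e2
      cases e3
      exact ⟨i, [], rfl, .nil⟩
    · exact ⟨j, _ :: p', rfl, .cons g x i h'⟩

/-- A finitely branching tree of constituents without infinite branches. -/
theorem finite_setOf_at {J : PreInterpretation.{u, v, w} L} (hJ : J.ModelsFEA)
    (hw : WellFounded J.Child) (d : J.Carrier) : {p | ∃ e, J.At d p e}.Finite := by
  induction d using hw.induction with
  | _ d ih =>
    by_cases hd : ∀ (n : ℕ) (f : L.Functions n) (x : Fin n → J.Carrier), J.fn f x ≠ d
    · refine (Set.finite_singleton []).subset ?_
      rintro p ⟨e, h⟩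
      exact (h.eq_nil hd).1
    · push Not at hd
      obtain ⟨n, f, y, rfl⟩ := hd
      refine ((Set.finite_singleton []).union (Set.finite_iUnion fun i : Fin n =>
        (ih (y i) ⟨n, f, y, i, rfl, rfl⟩).image (· ++ [⟨n, f, i⟩]))).subset ?_
      rintro p ⟨e, h⟩
      rcases h.fn_cases hJ with ⟨rfl, -⟩ | ⟨i, p', rfl, h'⟩
      · exact .inl rfl
      · exact .inr (Set.mem_iUnion.2 ⟨i, p', ⟨e, h'⟩, rfl⟩)

end PreInterpretation

open PreInterpretation

/-! ### Queries as conditions on variables and argument places -/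

namespace Query

variable {L : FirstOrder.Language.{u, v}}

/-- `Rel J Q m g` says that `g` solves `Q` with the `k`-th atom occurrence replaced by
equations that identify its `j`-th argument with the extra variable `(m + k, j)`. -/
def Rel (J : PreInterpretation.{u, v, w} L) : Query L → ℕ → (ℕ ⊕ ℕ × ℕ → J.Carrier) → Prop
  | tru, _, _ => True
  | fls, _, _ => False
  | eq s t, _, g => J.eval (g ∘ Sum.inl) s = J.eval (g ∘ Sum.inl) t
  | @atom _ n _ ts, m, g => ∀ j : Fin n, g (.inr (m, j)) = J.eval (g ∘ Sum.inl) (ts j)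
  | and Q₁ Q₂, m, g => Rel J Q₁ m g ∧ Rel J Q₂ (m + Q₁.card) g
  | ex x Q, m, g => ∃ d : J.Carrier, Rel J Q m (update g (.inl x) d)

/-- The predicate symbols of the atom occurrences. -/
def preds : Query L → List (Σ n, L.Relations n)
  | tru => []
  | fls => []
  | eq _ _ => []
  | atom p _ => [⟨_, p⟩]
  | and Q₁ Q₂ => Q₁.preds ++ Q₂.preds
  | ex _ Q => Q.preds

theorem length_preds (Q : Query L) : Q.preds.length = Q.card := by
  induction Q with
  | tru => rfl
  | fls => rfl
  | eq s t => rfl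
  | atom p ts => rfl
  | and Q₁ Q₂ h₁ h₂ => simp [preds, card, h₁, h₂]
  | ex x Q h => simpa [preds, card] using h

/-- All the variables that occur in a query, free or bound. -/
def vars : Query L → Finset ℕ
  | tru => ∅
  | fls => ∅
  | eq s t => s.varFinset ∪ t.varFinset
  | atom _ ts => Finset.univ.biUnion fun j => (ts j).varFinset
  | and Q₁ Q₂ => Q₁.vars ∪ Q₂.vars
  | ex _ Q => Q.vars

/-- The argument places of a list of predicate symbols numbered from `m` on. -/
def places : List (Σ n, L.Relations n) → ℕ → Set (ℕ × ℕ)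
  | [], _ => ∅
  | p :: ps, m => {z | z.1 = m ∧ z.2 < p.1} ∪ places ps (m + 1)

theorem places_append (ps qs : List (Σ n, L.Relations n)) (m : ℕ) :
    places (ps ++ qs) m = places ps m ∪ places qs (m + ps.length) := by
  induction ps generalizing m with
  | nil => simp [places]
  | cons p ps ih =>
    simp only [List.cons_append, places, ih, List.length_cons, Set.union_assoc]
    rw [show m + 1 + ps.length = m + (ps.length + 1) by omega]

theorem finite_places (ps : List (Σ n, L.Relations n)) (m : ℕ) : (places ps m).Finite := by
  induction ps generalizing m with
  | nil => exact Set.finite_empty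
  | cons p ps ih =>
    refine Set.Finite.union ?_ (ih _)
    refine ((Set.finite_singleton m).prod (Set.finite_Iio p.1)).subset ?_
    rintro z ⟨h1, h2⟩
    exact ⟨h1, h2⟩

theorem bounds_of_mem_places {ps : List (Σ n, L.Relations n)} {m : ℕ} {z : ℕ × ℕ}
    (hz : z ∈ places ps m) : m ≤ z.1 ∧ z.1 < m + ps.length := by
  induction ps generalizing m with
  | nil => exact hz.elim
  | cons p ps ih =>
    simp only [List.length_cons]
    rcases hz with ⟨h, -⟩ | h
    · omega
    · have := ih h
      omega

/-- The variables and argument places on which `Rel` depends. -/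
def support (Q : Query L) (m : ℕ) : Set (ℕ ⊕ ℕ × ℕ) :=
  Sum.inl '' (Q.vars : Set ℕ) ∪ Sum.inr '' places Q.preds m

theorem finite_support (Q : Query L) (m : ℕ) : (Q.support m).Finite :=
  (Q.vars.finite_toSet.image _).union ((finite_places _ _).image _)

theorem support_and_left (Q₁ Q₂ : Query L) (m : ℕ) :
    Q₁.support m ⊆ (Query.and Q₁ Q₂).support m := by
  refine Set.union_subset_union (Set.image_mono ?_) (Set.image_mono ?_)
  · simp [vars]
  · simp [preds, places_append]

theorem support_and_right (Q₁ Q₂ : Query L) (m : ℕ) :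
    Q₂.support (m + Q₁.card) ⊆ (Query.and Q₁ Q₂).support m := by
  refine Set.union_subset_union (Set.image_mono ?_) (Set.image_mono ?_)
  · simp [vars]
  · simp [preds, places_append, length_preds]

variable {J : PreInterpretation.{u, v, w} L}

theorem Rel.congr {Q : Query L} {m : ℕ} {g g' : ℕ ⊕ ℕ × ℕ → J.Carrier} (h : Rel J Q m g)
    (H : ∀ i ∈ Q.support m, g i = g' i) : Rel J Q m g' := by
  induction Q generalizing m g g' with
  | tru => trivial
  | fls => exact h
  | eq s t =>
    have e : ∀ u : L.Term ℕ, u.varFinset ⊆ (Query.eq s t).vars →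
        J.eval (g ∘ Sum.inl) u = J.eval (g' ∘ Sum.inl) u := fun u hu =>
      J.eval_congr u fun x hx => H _ (.inl ⟨x, hu hx, rfl⟩)
    simp only [Rel] at h ⊢
    rw [← e s (by simp [vars]), ← e t (by simp [vars]), h]
  | @atom n p ts =>
    intro j
    rw [← H (.inr (m, j)) (.inr ⟨_, .inl ⟨rfl, j.2⟩, rfl⟩), h j]
    refine J.eval_congr _ fun x hx => H _ (.inl ⟨x, ?_, rfl⟩)
    simp only [vars, Finset.coe_biUnion, Set.mem_iUnion]
    exact ⟨j, by simp, hx⟩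
  | and Q₁ Q₂ h₁ h₂ =>
    exact ⟨h₁ h.1 fun i hi => H i (support_and_left _ _ _ hi),
      h₂ h.2 fun i hi => H i (support_and_right _ _ _ hi)⟩
  | ex x Q ih =>
    obtain ⟨d, hd⟩ := h
    refine ⟨d, ih hd fun i hi => ?_⟩
    by_cases hx : i = .inl x
    · subst hx; simp
    · simp [hx, H i hi]

/-- Equations hold in a product componentwise, and existential witnesses can be paired. -/
theorem rel_prod {J₁ J₂ : PreInterpretation.{u, v, w} L} {Q : Query L} {m : ℕ}
    {g : ℕ ⊕ ℕ × ℕ → (J₁.prod J₂).Carrier} (h₁ : Rel J₁ Q m fun i => (g i).1)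
    (h₂ : Rel J₂ Q m fun i => (g i).2) : Rel (J₁.prod J₂) Q m g := by
  induction Q generalizing m g with
  | tru => trivial
  | fls => exact h₁
  | eq s t =>
    simp only [Rel, eval_prod]
    exact Prod.ext h₁ h₂
  | atom p ts =>
    intro j
    rw [eval_prod]
    exact Prod.ext (h₁ j) (h₂ j)
  | and Q₁ Q₂ ih₁ ih₂ => exact ⟨ih₁ h₁.1 h₂.1, ih₂ h₁.2 h₂.2⟩
  | ex x Q ih =>
    obtain ⟨d₁, h₁⟩ := h₁
    obtain ⟨d₂, h₂⟩ := h₂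
    let d : (J₁.prod J₂).Carrier := (d₁, d₂)
    refine ⟨d, ih (h₁.congr fun i _ => ?_) (h₂.congr fun i _ => ?_)⟩ <;>
    · rw [update_apply, update_apply]
      split_ifs <;> rfl

theorem exists_finite_eval_comp (h : J.Valuation) (t : L.Term ℕ) :
    ∃ V : Set J.Carrier, V.Finite ∧ J.eval h t ∈ V ∧
      ∀ (J' : PreInterpretation.{u, v, w} L) (ρ : J.Carrier → J'.Carrier),
        CommutesOn J J' V ρ → J'.eval (ρ ∘ h) t = ρ (J.eval h t) := by
  induction t with
  | var x => exact ⟨{h x}, Set.finite_singleton _, rfl, fun _ _ _ => rfl⟩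
  | func f ts ih =>
    choose V hV hm H using ih
    refine ⟨{J.eval h (Language.Term.func f ts)} ∪ ⋃ i, V i,
      (Set.finite_singleton _).union (Set.finite_iUnion hV), .inl rfl, fun J' ρ hρ => ?_⟩
    have hs : ∀ i, V i ⊆ {J.eval h (Language.Term.func f ts)} ∪ ⋃ i, V i := fun i =>
      (Set.subset_iUnion V i).trans Set.subset_union_right
    have e := hρ f (fun i => J.eval h (ts i)) (.inl rfl) fun i => hs i (hm i)
    refine Eq.trans (congrArg (J'.fn f) (funext fun i => ?_)) e.symm
    exact H i J' ρ (hρ.mono (hs i))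

/-- A solution involves only the finitely many values of subterms met in verifying it, so a map
respecting the functions there preserves it. Finiteness is what allows mapping a possibly
non-well-founded model into a term model. -/
theorem Rel.exists_finite {Q : Query L} {m : ℕ} {g : ℕ ⊕ ℕ × ℕ → J.Carrier}
    (h : Rel J Q m g) : ∃ V : Set J.Carrier, V.Finite ∧
      ∀ (J' : PreInterpretation.{u, v, w} L) (ρ : J.Carrier → J'.Carrier),
        CommutesOn J J' V ρ → Rel J' Q m (ρ ∘ g) := by
  induction Q generalizing m g with
  | tru => exact ⟨∅, Set.finite_empty, fun _ _ _ => trivial⟩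
  | fls => exact h.elim
  | eq s t =>
    obtain ⟨V₁, hV₁, -, H₁⟩ := exists_finite_eval_comp (g ∘ Sum.inl) s
    obtain ⟨V₂, hV₂, -, H₂⟩ := exists_finite_eval_comp (g ∘ Sum.inl) t
    refine ⟨V₁ ∪ V₂, hV₁.union hV₂, fun J' ρ hρ => ?_⟩
    have e₁ := H₁ J' ρ (hρ.mono Set.subset_union_left)
    have e₂ := H₂ J' ρ (hρ.mono Set.subset_union_right)
    exact e₁.trans ((congrArg ρ h).trans e₂.symm)
  | atom p ts =>
    choose V hV _ H using fun j => exists_finite_eval_comp (g ∘ Sum.inl) (ts j)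
    refine ⟨⋃ j, V j, Set.finite_iUnion hV, fun J' ρ hρ j => ?_⟩
    exact (congrArg ρ (h j)).trans (H j J' ρ (hρ.mono (Set.subset_iUnion V j))).symm
  | and Q₁ Q₂ ih₁ ih₂ =>
    obtain ⟨V₁, hV₁, H₁⟩ := ih₁ h.1
    obtain ⟨V₂, hV₂, H₂⟩ := ih₂ h.2
    exact ⟨V₁ ∪ V₂, hV₁.union hV₂, fun J' ρ hρ =>
      ⟨H₁ J' ρ (hρ.mono Set.subset_union_left), H₂ J' ρ (hρ.mono Set.subset_union_right)⟩⟩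
  | ex x Q ih =>
    obtain ⟨d, hd⟩ := h
    obtain ⟨V, hV, H⟩ := ih hd
    refine ⟨V, hV, fun J' ρ hρ => ⟨ρ d, ?_⟩⟩
    rw [← comp_update]
    exact H J' ρ hρ

/-! ### Multiinterpretations -/

/-- The generalized atoms with arguments `a` belong to the members of the
multiinterpretation. -/
def Fits (J : PreInterpretation.{u, v, w} L) :
    List (Σ n, L.Relations n) → ℕ → List J.Interpretation → (ℕ × ℕ → J.Carrier) → Prop
  | [], _, [], _ => True
  | p :: ps, m, I :: Is, a =>
      (⟨p.1, p.2, fun j => a (m, j)⟩ : J.Base) ∈ I ∧ Fits J ps (m + 1) Is a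
  | [], _, _ :: _, _ => False
  | _ :: _, _, [], _ => False

theorem Fits.congr {ps : List (Σ n, L.Relations n)} {m : ℕ} {Is : List J.Interpretation}
    {a a' : ℕ × ℕ → J.Carrier} (h : Fits J ps m Is a) (H : ∀ z ∈ places ps m, a z = a' z) :
    Fits J ps m Is a' := by
  induction ps generalizing m Is with
  | nil => cases Is <;> exact h
  | cons p ps ih =>
    cases Is with
    | nil => exact h
    | cons I Is =>
      refine ⟨?_, ih h.2 fun z hz => H z (.inr hz)⟩
      have : (fun j : Fin p.1 => a' (m, j)) = fun j : Fin p.1 => a (m, j) :=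
        funext fun j => (H _ (.inl ⟨rfl, j.2⟩)).symm
      rw [this]
      exact h.1

theorem fits_append {ps qs : List (Σ n, L.Relations n)} {m : ℕ} {Is : List J.Interpretation}
    {a : ℕ × ℕ → J.Carrier} : Fits J (ps ++ qs) m Is a ↔
      Fits J ps m (Is.take ps.length) a ∧ Fits J qs (m + ps.length) (Is.drop ps.length) a := by
  induction ps generalizing m Is with
  | nil => simp [Fits]
  | cons p ps ih =>
    cases Is with
    | nil => simp [Fits]
    | cons I Is =>
      simp only [List.cons_append, Fits, ih, List.length_cons, List.take_succ_cons,
        List.drop_succ_cons, and_assoc]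
      rw [show m + 1 + ps.length = m + (ps.length + 1) by omega]

/-- The multiinterpretation whose members are the single atoms with arguments `a`. -/
def atoms (J : PreInterpretation.{u, v, w} L) (a : ℕ × ℕ → J.Carrier) :
    List (Σ n, L.Relations n) → ℕ → List J.Interpretation
  | [], _ => []
  | p :: ps, m => {⟨p.1, p.2, fun j => a (m, j)⟩} :: atoms J a ps (m + 1)

theorem length_atoms (a : ℕ × ℕ → J.Carrier) (ps : List (Σ n, L.Relations n)) (m : ℕ) :
    (atoms J a ps m).length = ps.length := by
  induction ps generalizing m with
  | nil => rfl
  | cons p ps ih => simp [atoms, ih]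

theorem fits_atoms (a : ℕ × ℕ → J.Carrier) (ps : List (Σ n, L.Relations n)) (m : ℕ) :
    Fits J ps m (atoms J a ps m) a := by
  induction ps generalizing m with
  | nil => trivial
  | cons p ps ih => exact ⟨rfl, ih _⟩

theorem eq_of_fits_atoms {a a' : ℕ × ℕ → J.Carrier} {ps qs : List (Σ n, L.Relations n)}
    {m : ℕ} (h : Fits J qs m (atoms J a ps m) a') :
    qs = ps ∧ ∀ z ∈ places ps m, a' z = a z := by
  induction ps generalizing m qs with
  | nil =>
    cases qs with
    | nil => exact ⟨rfl, fun z hz => hz.elim⟩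
    | cons q qs => exact h.elim
  | cons p ps ih =>
    cases qs with
    | nil => exact h.elim
    | cons q qs =>
      obtain ⟨h1, h2⟩ := h
      obtain ⟨rfl, h3⟩ := ih h2
      obtain ⟨n, r⟩ := p
      obtain ⟨n', r'⟩ := q
      simp only [Set.mem_singleton_iff, Sigma.mk.injEq] at h1
      obtain ⟨rfl, h1⟩ := h1
      obtain ⟨rfl, h4⟩ := Prod.mk.inj (eq_of_heq h1)
      refine ⟨rfl, ?_⟩
      rintro ⟨z1, z2⟩ (⟨hz, hz'⟩ | hz)
      · simp only at hz hz'
        subst hz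
        exact congrFun h4 ⟨z2, hz'⟩
      · exact h3 _ hz

/-- Separates the logical part of a query from its atoms; the arguments `a` can be quantified
outermost because distinct occurrences own disjoint places. -/
theorem mem_msol_iff {Q : Query L} {m : ℕ} {Is : List J.Interpretation} {h : J.Valuation}
    (hl : Is.length = Q.card) :
    h ∈ Q.msol J Is ↔ ∃ a, Rel J Q m (Sum.elim h a) ∧ Fits J Q.preds m Is a := by
  have hne := J.nonempty
  induction Q generalizing m Is h with
  | tru =>
    obtain rfl := List.eq_nil_of_length_eq_zero hl
    simp [msol, Rel, preds, Fits]
  | fls => simp [msol, Rel]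
  | eq s t =>
    obtain rfl := List.eq_nil_of_length_eq_zero hl
    simp [msol, Rel, preds, Fits]
  | @atom n p ts =>
    obtain ⟨I, rfl⟩ := List.length_eq_one_iff.1 hl
    simp only [msol, Set.mem_ofPred_eq, Rel, preds, Fits, and_true, Sum.elim_inr,
      Sum.elim_comp_inl]
    constructor
    · rintro ⟨I', e, hI⟩
      cases e
      refine ⟨fun z => if hz : z.2 < n then J.eval h (ts ⟨z.2, hz⟩) else h 0, ?_, ?_⟩
      · simp
      · simpa using hI
    · rintro ⟨a, ha, hI⟩
      refine ⟨I, rfl, ?_⟩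
      rw [← funext ha]
      exact hI
  | and Q₁ Q₂ ih₁ ih₂ =>
    simp only [card] at hl
    have hl₁ : (Is.take Q₁.card).length = Q₁.card := by simp [hl]
    have hl₂ : (Is.drop Q₁.card).length = Q₂.card := by simp [hl]
    simp only [msol, Set.mem_inter_iff, ih₁ (m := m) hl₁, ih₂ (m := m + Q₁.card) hl₂, preds,
      fits_append, length_preds, Rel]
    constructor
    · rintro ⟨⟨a₁, h₁, k₁⟩, a₂, h₂, k₂⟩
      -- The two conjuncts use places on either side of `m + Q₁.card`, so their argument families
      -- glue.
      let a : ℕ × ℕ → J.Carrier := fun z => if z.1 < m + Q₁.card then a₁ z else a₂ z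
      have e₁ : ∀ z ∈ places Q₁.preds m, a₁ z = a z := fun z hz => by
        have := (bounds_of_mem_places hz).2
        rw [length_preds] at this
        simp [a, this]
      have e₂ : ∀ z ∈ places Q₂.preds (m + Q₁.card), a₂ z = a z := fun z hz => by
        have := (bounds_of_mem_places hz).1
        simp [a, not_lt.2 this]
      refine ⟨a, ⟨h₁.congr ?_, h₂.congr ?_⟩, k₁.congr e₁, k₂.congr e₂⟩
      · rintro _ (⟨x, -, rfl⟩ | ⟨z, hz, rfl⟩)
        exacts [rfl, e₁ z hz]
      · rintro _ (⟨x, -, rfl⟩ | ⟨z, hz, rfl⟩)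
        exacts [rfl, e₂ z hz]
    · rintro ⟨a, ⟨h₁, h₂⟩, k₁, k₂⟩
      exact ⟨⟨a, h₁, k₁⟩, a, h₂, k₂⟩
  | ex x Q ih =>
    have e : ∀ (a : ℕ × ℕ → J.Carrier) (d : J.Carrier),
        update (Sum.elim h a) (.inl x) d = Sum.elim (update h x d) a := fun a d =>
      Sum.update_elim_inl
    simp only [msol, Set.mem_ofPred_eq, Rel, preds, e]
    constructor
    · rintro ⟨d, hd⟩
      obtain ⟨a, h1, h2⟩ := (ih (m := m) hl).1 hd
      exact ⟨a, ⟨d, h1⟩, h2⟩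
    · rintro ⟨a, ⟨d, h1⟩, h2⟩
      exact ⟨d, (ih (m := m) hl).2 ⟨a, h1, h2⟩⟩

theorem Holds.mem_msol {I : J.Interpretation} {Q : Query L} {h : J.Valuation}
    (H : Holds J I Q h) : h ∈ Q.msol J (List.replicate Q.card I) := by
  induction Q generalizing h with
  | tru => trivial
  | fls => exact H
  | eq s t => exact H
  | atom p ts => exact ⟨I, rfl, H⟩
  | and Q₁ Q₂ h₁ h₂ =>
    refine ⟨?_, ?_⟩
    · simpa [card, List.take_replicate] using h₁ H.1
    · simpa [card, List.drop_replicate] using h₂ H.2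
  | ex x Q ih =>
    obtain ⟨d, hd⟩ := H
    exact ⟨d, ih hd⟩

theorem holds_of_mem_msol {Q : Query L} {Is : List J.Interpretation} {h : J.Valuation}
    (H : h ∈ Q.msol J Is) : Holds J Set.univ Q h := by
  induction Q generalizing Is h with
  | tru => trivial
  | fls => exact H
  | eq s t => exact H
  | atom p ts => trivial
  | and Q₁ Q₂ h₁ h₂ => exact ⟨h₁ H.1, h₂ H.2⟩
  | ex x Q ih =>
    obtain ⟨d, hd⟩ := H
    exact ⟨d, ih hd⟩

/-- Evaluated on the one-atom interpretations read off from `g`, the inclusion of solution sets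
forces `Q'` to use the same predicates with the same arguments. -/
theorem Le.preds_eq_and_rel {Q Q' : Query L} (h : Le.{u, v, w} Q Q') (hJ : J.ModelsFEA)
    {g : ℕ ⊕ ℕ × ℕ → J.Carrier} (hg : Rel J Q 0 g) : Q'.preds = Q.preds ∧ Rel J Q' 0 g := by
  obtain ⟨hc, hs⟩ := h J hJ
  obtain ⟨k, a, rfl⟩ : ∃ k a, g = Sum.elim k a := ⟨_, _, (Sum.elim_comp_inl_inr g).symm⟩
  have hl : (atoms J a Q.preds 0).length = Q.card := by rw [length_atoms, length_preds]
  have hk := hs _ hl ((mem_msol_iff (m := 0) hl).2 ⟨a, hg, fits_atoms a _ _⟩)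
  obtain ⟨a', h1, h2⟩ := (mem_msol_iff (m := 0) (hl.trans hc)).1 hk
  obtain ⟨e1, e2⟩ := eq_of_fits_atoms h2
  refine ⟨e1, h1.congr ?_⟩
  rintro _ (⟨x, -, rfl⟩ | ⟨z, hz, rfl⟩)
  · rfl
  · rw [e1] at hz
    exact e2 z hz

theorem le_of_rel {Q Q' : Query L} (hp : Q.preds = Q'.preds)
    (H : ∀ J : PreInterpretation.{u, v, w} L, J.ModelsFEA → ∀ g, Rel J Q 0 g → Rel J Q' 0 g) :
    Le.{u, v, w} Q Q' := by
  intro J hJ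
  have hc : Q.card = Q'.card := by rw [← length_preds, hp, length_preds]
  refine ⟨hc, fun Is hl k hk => ?_⟩
  obtain ⟨a, h1, h2⟩ := (mem_msol_iff (m := 0) hl).1 hk
  exact (mem_msol_iff (m := 0) (hl.trans hc)).2 ⟨a, H J hJ _ h1, hp ▸ h2⟩

end Query

/-! ### Tests and homomorphisms -/

variable {L : FirstOrder.Language.{u, v}}

/-- Properties of a family of elements of a pre-interpretation: coincidence of two constituents,
and the outermost function symbol of a constituent. -/
inductive Test (L : FirstOrder.Language.{u, v}) : Type u
  | eq (i : ℕ ⊕ ℕ × ℕ) (p : List (Σ n, L.Functions n × Fin n)) (j : ℕ ⊕ ℕ × ℕ)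
      (q : List (Σ n, L.Functions n × Fin n)) : Test L
  | head (i : ℕ ⊕ ℕ × ℕ) (p : List (Σ n, L.Functions n × Fin n)) {n : ℕ}
      (f : L.Functions n) : Test L

/-- The family `g` passes a test. -/
def Passes (J : PreInterpretation.{u, v, w} L) (g : ℕ ⊕ ℕ × ℕ → J.Carrier) : Test L → Prop
  | .eq i p j q => ∃ e, J.At (g i) p e ∧ J.At (g j) q e
  | .head i p f => ∃ x, J.At (g i) p (J.fn f x)

theorem Passes.fst {J₁ J₂ : PreInterpretation.{u, v, w} L}
    {g : ℕ ⊕ ℕ × ℕ → (J₁.prod J₂).Carrier} {t : Test L} (h : Passes (J₁.prod J₂) g t) :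
    Passes J₁ (fun i => (g i).1) t := by
  cases t with
  | eq i p j q =>
    obtain ⟨e, h₁, h₂⟩ := h
    exact ⟨e.1, h₁.fst, h₂.fst⟩
  | head i p f =>
    obtain ⟨x, hx⟩ := h
    exact ⟨_, hx.fst⟩

theorem Passes.snd {J₁ J₂ : PreInterpretation.{u, v, w} L}
    {g : ℕ ⊕ ℕ × ℕ → (J₁.prod J₂).Carrier} {t : Test L} (h : Passes (J₁.prod J₂) g t) :
    Passes J₂ (fun i => (g i).2) t := by
  cases t with
  | eq i p j q =>
    obtain ⟨e, h₁, h₂⟩ := h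
    exact ⟨e.2, h₁.snd, h₂.snd⟩
  | head i p f =>
    obtain ⟨x, hx⟩ := h
    exact ⟨_, hx.snd⟩

/-- A family in a well-founded model that passes no more tests than a second family is mapped
to the second family by a homomorphism. -/
theorem exists_hom_of_passes {P J : PreInterpretation.{u, v, w} L} (hP : P.ModelsFEA)
    (hw : WellFounded P.Child) (hJ : J.ModelsFEA) (g : ℕ ⊕ ℕ × ℕ → P.Carrier)
    (r : ℕ ⊕ ℕ × ℕ → J.Carrier) (H : ∀ t, Passes P g t → Passes J r t) :
    ∃ ρ : P.Carrier → J.Carrier, CommutesOn P J Set.univ ρ ∧ ρ ∘ g = r := by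
  classical
  let Q : P.Carrier → J.Carrier → Prop := fun d e => ∃ i p, P.At (g i) p d ∧ J.At (r i) p e
  -- An indecomposable constituent of `g` goes to the constituent of `r` on the same path; equality
  -- tests make this independent of the path, and head tests handle decomposable constituents.
  let α : P.Carrier → J.Carrier := fun d =>
    if hd : ∃ e, Q d e then hd.choose else J.nonempty.some
  obtain ⟨ρ, hρ, hα⟩ := hP.exists_commutesOn J (V := Set.univ)
    (Subrelation.wf (fun h => h.2.2) hw) α
  have key : ∀ d i p e, P.At (g i) p d → J.At (r i) p e → ρ d = e := by
    intro d
    induction d using hw.induction with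
    | _ d ih =>
      intro i p e h₁ h₂
      by_cases hd : ∀ (n : ℕ) (f : L.Functions n) (x : Fin n → P.Carrier), P.fn f x ≠ d
      · have hq : ∃ e, Q d e := ⟨e, i, p, h₁, h₂⟩
        rw [hα d hd, show α d = hq.choose from dif_pos hq]
        obtain ⟨j, q, h₃, h₄⟩ := hq.choose_spec
        obtain ⟨e', h₅, h₆⟩ := H (.eq i p j q) ⟨d, h₁, h₃⟩
        exact (h₄.unique hJ h₆).trans (h₅.unique hJ h₂)
      · push Not at hd
        obtain ⟨n, f, x, rfl⟩ := hd
        obtain ⟨y, hy⟩ := H (.head i p f) ⟨x, h₁⟩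
        rw [h₂.unique hJ hy, hρ f x trivial fun _ => trivial]
        refine congrArg (J.fn f) (funext fun j => ?_)
        exact ih (x j) ⟨n, f, x, j, rfl, rfl⟩ i _ _ (.cons f x j h₁) (.cons f y j hy)
  exact ⟨ρ, hρ, funext fun i => key _ i [] _ .nil .nil⟩

/-- A family of terms almost all of which are distinct variables passes only finitely many
tests apart from the trivial ones. -/
theorem finite_setOf_passes {J : PreInterpretation.{u, v, w} L} (hJ : J.ModelsFEA)
    (d : J.Carrier) {F : Set (ℕ ⊕ ℕ × ℕ)} (hF : F.Finite)
    (s : ℕ ⊕ ℕ × ℕ → (J.termModel d (ℕ ⊕ ℕ × ℕ)).Carrier)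
    (hs : ∀ i, i ∉ F → s i = Language.Term.var i) :
    {t : Test L | Passes (J.termModel d _) s t ∧ ∀ i, t ≠ .eq i [] i []}.Finite := by
  let T := J.termModel d (ℕ ⊕ ℕ × ℕ)
  have hTm : T.ModelsFEA := hJ.termModel d _
  let A : Set ((ℕ ⊕ ℕ × ℕ) × List (Σ n, L.Functions n × Fin n)) :=
    ⋃ i ∈ F, Prod.mk i '' {p | ∃ e, T.At (s i) p e}
  have hA : A.Finite := hF.biUnion fun i _ =>
    (T.finite_setOf_at hTm (J.wellFounded_child_termModel d _) (s i)).image _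
  have memA : ∀ i p e, i ∈ F → T.At (s i) p e → (i, p) ∈ A := fun i p e hi h =>
    Set.mem_biUnion hi ⟨p, ⟨e, h⟩, rfl⟩
  have atvar : ∀ i p e, i ∉ F → T.At (s i) p e → p = [] ∧ e = Language.Term.var i := by
    intro i p e hi h
    rw [hs i hi] at h
    exact h.eq_nil fun n f x => J.termModel_fn_ne_var d _ i f x
  -- Besides positions inside the terms indexed by `F`, an equality test can involve a bare variable
  -- occurring in one of these terms.
  let B : Set ((ℕ ⊕ ℕ × ℕ) × List (Σ n, L.Functions n × Fin n)) :=
    A ∪ ⋃ z ∈ A, {y | y.2 = [] ∧ T.At (s z.1) z.2 (Language.Term.var y.1)}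
  have hB : B.Finite := by
    refine hA.union (hA.biUnion fun z _ => Set.Subsingleton.finite ?_)
    rintro ⟨i, p⟩ ⟨rfl, h₁⟩ ⟨j, q⟩ ⟨rfl, h₂⟩
    have e : i = j := Language.Term.var.inj (h₁.unique hTm h₂)
    rw [e]
  have hE : ((fun z : ((ℕ ⊕ ℕ × ℕ) × List (Σ n, L.Functions n × Fin n)) ×
      ((ℕ ⊕ ℕ × ℕ) × List (Σ n, L.Functions n × Fin n)) =>
        Test.eq z.1.1 z.1.2 z.2.1 z.2.2) '' (B ×ˢ B)).Finite := (hB.prod hB).image _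
  have hH : (⋃ z ∈ A, {t : Test L | ∃ (n : ℕ) (f : L.Functions n),
      t = .head z.1 z.2 f ∧ ∃ x, T.At (s z.1) z.2 (T.fn f x)}).Finite := by
    refine hA.biUnion fun z _ => Set.Subsingleton.finite ?_
    rintro _ ⟨n, f, rfl, x, h₁⟩ _ ⟨m, f', rfl, x', h₂⟩
    cases hTm.fn_eq (h₁.unique hTm h₂)
    rfl
  refine (hE.union hH).subset ?_
  rintro (⟨i, p, j, q⟩ | ⟨i, p, f⟩) ⟨ht, hne⟩
  · left
    obtain ⟨e, h₁, h₂⟩ := ht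
    refine ⟨((i, p), (j, q)), ?_, rfl⟩
    by_cases hi : i ∈ F
    · by_cases hj : j ∈ F
      · exact ⟨.inl (memA _ _ _ hi h₁), .inl (memA _ _ _ hj h₂)⟩
      · obtain ⟨rfl, rfl⟩ := atvar _ _ _ hj h₂
        exact ⟨.inl (memA _ _ _ hi h₁), .inr (Set.mem_biUnion (memA _ _ _ hi h₁) ⟨rfl, h₁⟩)⟩
    · obtain ⟨rfl, rfl⟩ := atvar _ _ _ hi h₁
      by_cases hj : j ∈ F
      · exact ⟨.inr (Set.mem_biUnion (memA _ _ _ hj h₂) ⟨rfl, h₂⟩), .inl (memA _ _ _ hj h₂)⟩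
      · obtain ⟨rfl, e⟩ := atvar _ _ _ hj h₂
        cases Language.Term.var.inj e
        exact absurd rfl (hne i)
  · right
    obtain ⟨x, hx⟩ := ht
    by_cases hi : i ∈ F
    · exact Set.mem_biUnion (memA _ _ _ hi hx) ⟨_, f, rfl, x, hx⟩
    · exact absurd (atvar _ _ _ hi hx).2 (J.termModel_fn_ne_var d _ i f x)

/-! ### Generic solutions and finiteness -/

namespace Query

/-- The tests that are passed by all the solutions of `Q` in models of the free equality
axioms. -/
def tests (Q : Query L) : Set (Test L) :=
  {t | ∀ J : PreInterpretation.{u, v, w} L, J.ModelsFEA → ∀ g, Rel J Q 0 g → Passes J g t}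

theorem eq_nil_mem_tests (Q : Query L) (i : ℕ ⊕ ℕ × ℕ) :
    Test.eq i [] i [] ∈ tests.{u, v, w} Q :=
  fun _ _ g _ => ⟨g i, .nil, .nil⟩

/-- A solution in a well-founded model can be improved so as to fail given tests that are not
passed by all solutions. -/
theorem exists_rel_not_passes (Q : Query L) {T : PreInterpretation.{u, v, w} L}
    (hT : T.ModelsFEA) (hw : WellFounded T.Child) {s : ℕ ⊕ ℕ × ℕ → T.Carrier}
    (hs : Rel T Q 0 s) {G : Set (Test L)} (hG : G.Finite)
    (hGQ : ∀ t ∈ G, t ∉ tests.{u, v, w} Q) :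
    ∃ P : PreInterpretation.{u, v, w} L, P.ModelsFEA ∧ WellFounded P.Child ∧
      ∃ g : ℕ ⊕ ℕ × ℕ → P.Carrier, Rel P Q 0 g ∧
        ∀ t, Passes P g t → Passes T s t ∧ t ∉ G := by
  induction G, hG using Set.Finite.induction_on with
  | empty => exact ⟨T, hT, hw, s, hs, fun t ht => ⟨ht, fun h => h⟩⟩
  | @insert t G _ _ ih =>
    obtain ⟨P, hP, hPw, g, hg, H⟩ := ih fun t ht => hGQ t (.inr ht)
    have ht := hGQ t (.inl rfl)
    simp only [tests, Set.mem_ofPred_eq, not_forall] at ht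
    obtain ⟨J, hJ, r, hr, hrt⟩ := ht
    -- Pairing with a solution failing `t` kills `t` and creates no new passed test, since tests
    -- project to both factors.
    let k : ℕ ⊕ ℕ × ℕ → (P.prod J).Carrier := fun i => (g i, r i)
    refine ⟨P.prod J, hP.prod hJ, wellFounded_child_prod J hPw, k, rel_prod hg hr,
      fun t' ht' => ⟨(H t' ht'.fst).1, ?_⟩⟩
    rintro (rfl | h)
    · exact hrt ht'.snd
    · exact (H t' ht'.fst).2 h

theorem le_of_tests_subset {Q Q' : Query L} (hp : Q.preds = Q'.preds)
    {T : PreInterpretation.{u, v, w} L} (hT : T.ModelsFEA) (hw : WellFounded T.Child)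
    {s : ℕ ⊕ ℕ × ℕ → T.Carrier} (hs : Rel T Q' 0 s)
    (hfin : {t | Passes T s t ∧ ∀ i, t ≠ .eq i [] i []}.Finite)
    (hsub : tests.{u, v, w} Q' ⊆ tests.{u, v, w} Q) : Le.{u, v, w} Q Q' := by
  refine le_of_rel hp fun J hJ r hr => ?_
  -- The generic solution: remove every nontrivial test passed by `s` but not forced by `Q'`.
  obtain ⟨P, hP, hPw, g, hg, H⟩ := Q'.exists_rel_not_passes hT hw hs
    (hfin.subset (Set.sdiff_subset (t := tests.{u, v, w} Q'))) fun t ht => ht.2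
  have hgr : ∀ t, Passes P g t → Passes J r t := by
    intro t ht
    obtain ⟨h₁, h₂⟩ := H t ht
    by_cases hm : t ∈ tests.{u, v, w} Q'
    · exact hsub hm J hJ r hr
    · refine absurd ⟨⟨h₁, ?_⟩, hm⟩ h₂
      rintro i rfl
      exact hm (eq_nil_mem_tests Q' i)
  obtain ⟨ρ, hρ, rfl⟩ := exists_hom_of_passes hP hPw hJ g r hgr
  obtain ⟨V, -, hV⟩ := hg.exists_finite
  exact hV J ρ (hρ.mono (Set.subset_univ V))

theorem Consistent.exists_rel {Q : Query L} (hQ : Consistent.{u, v, w} Q) :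
    ∃ J : PreInterpretation.{u, v, w} L, J.ModelsFEA ∧ ∃ g, Rel J Q 0 g := by
  obtain ⟨J, hJ, I, h, H⟩ := hQ
  obtain ⟨a, ha, -⟩ := (mem_msol_iff (m := 0) (by simp)).1 H.mem_msol
  exact ⟨J, hJ, _, ha⟩

/-- A consistent query has a solution in terms where almost all variables are free. -/
theorem Consistent.exists_finite_passes {Q : Query L} (hQ : Consistent.{u, v, w} Q) :
    ∃ T : PreInterpretation.{u, v, w} L, T.ModelsFEA ∧ WellFounded T.Child ∧
      ∃ s, Rel T Q 0 s ∧ {t | Passes T s t ∧ ∀ i, t ≠ .eq i [] i []}.Finite := by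
  classical
  obtain ⟨J, hJ, g, hg⟩ := hQ.exists_rel
  obtain ⟨V, hV, H⟩ := hg.exists_finite
  let d : J.Carrier := g (.inl 0)
  let T := J.termModel d (ℕ ⊕ ℕ × ℕ)
  -- Unfold the finite part `V` into terms; indices outside the support can then be sent to distinct
  -- variables.
  obtain ⟨ρ, hρ, -⟩ := hJ.exists_commutesOn T (hJ.wellFounded_child_inter hV)
    fun _ => T.nonempty.some
  let s : ℕ ⊕ ℕ × ℕ → T.Carrier := fun i =>
    if i ∈ Q.support 0 then ρ (g i) else Language.Term.var i
  refine ⟨T, hJ.termModel d _, J.wellFounded_child_termModel d _, s,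
    (H T ρ hρ).congr fun i hi => ?_,
    finite_setOf_passes hJ d (Q.finite_support 0) s fun i hi => if_neg hi⟩
  exact (if_pos hi).symm

theorem Consistent.finite_generalizationClasses {Q : Query L} (hQ : Consistent.{u, v, w} Q) :
    (generalizationClasses.{u, v, w} Q).Finite := by
  obtain ⟨T, hT, hw, s, hs, hfin⟩ := hQ.exists_finite_passes
  let Δ : Set (Test L) := {t | ∀ i, t ≠ .eq i [] i []}
  have hD : ((fun Q' => tests.{u, v, w} Q' ∩ Δ) '' {Q' | Le.{u, v, w} Q Q'}).Finite := by
    refine hfin.finite_subsets.subset ?_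
    rintro _ ⟨Q', hQ', rfl⟩ t ⟨ht, hne⟩
    exact ⟨ht T hT s (hQ'.preds_eq_and_rel hT hs).2, hne⟩
  have hsub : ∀ Q₁ Q₂ : Query L, tests.{u, v, w} Q₁ ∩ Δ = tests.{u, v, w} Q₂ ∩ Δ →
      tests.{u, v, w} Q₁ ⊆ tests.{u, v, w} Q₂ := by
    intro Q₁ Q₂ h t ht
    by_cases hne : t ∈ Δ
    · exact (h.subset ⟨ht, hne⟩).1
    · obtain ⟨i, rfl⟩ : ∃ i, t = .eq i [] i [] := not_forall_not.1 hne
      exact eq_nil_mem_tests Q₂ i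
  have hle : ∀ Q₁ Q₂ : Query L, Le.{u, v, w} Q Q₁ → Le.{u, v, w} Q Q₂ →
      tests.{u, v, w} Q₁ ∩ Δ = tests.{u, v, w} Q₂ ∩ Δ → Le.{u, v, w} Q₁ Q₂ := by
    intro Q₁ Q₂ h₁ h₂ h
    obtain ⟨e₁, -⟩ := h₁.preds_eq_and_rel hT hs
    obtain ⟨e₂, r₂⟩ := h₂.preds_eq_and_rel hT hs
    exact le_of_tests_subset (e₁.trans e₂.symm) hT hw r₂ hfin (hsub _ _ h.symm)
  have : Nonempty (Query L) := ⟨Q⟩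
  -- Each set of tests that occurs is sent to the class of one chosen generalization having it.
  refine (hD.image fun D => Quotient.mk (equivalentSetoid.{u, v, w} L)
    (invFunOn (fun Q' => tests.{u, v, w} Q' ∩ Δ) {Q' | Le.{u, v, w} Q Q'} D)).subset ?_
  rintro _ ⟨Q', hQ', rfl⟩
  refine ⟨_, ⟨Q', hQ', rfl⟩, ?_⟩
  have hex : ∃ a ∈ {Q' | Le.{u, v, w} Q Q'},
    (fun Q' => tests.{u, v, w} Q' ∩ Δ) a = tests.{u, v, w} Q' ∩ Δ := ⟨Q', hQ', rfl⟩
  have h₁ := invFunOn_mem hex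
  have h₂ := invFunOn_eq hex
  exact Quotient.sound ⟨hle _ _ h₁ hQ' h₂, hle _ _ hQ' h₁ h₂.symm⟩

/-- An inconsistent `Q'` has no solutions, hence would lie below `Q`. -/
theorem consistent_of_lt {Q Q' : Query L} (h : Lt.{u, v, w} Q Q') :
    Consistent.{u, v, w} Q' := by
  by_contra hc
  exact h.2 fun J hJ => ⟨(h.1 J hJ).1.symm, fun Is _ k hk =>
    (hc ⟨J, hJ, Set.univ, k, holds_of_mem_msol hk⟩).elim⟩

end Query

end ConjQuery

theorem mainTheorem7 (L : FirstOrder.Language.{u, v}) [Nonempty L.Constants] :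
    (∀ Q : ConjQuery.Query L, ConjQuery.Query.Consistent.{u, v, w} Q →
      (ConjQuery.Query.generalizationClasses.{u, v, w} Q).Finite) ∧
    ¬ ∃ Q : ℕ → ConjQuery.Query L, ∀ n : ℕ,
      ConjQuery.Query.Lt.{u, v, w} (Q n) (Q (n + 1)) := by
  refine ⟨fun Q hQ => hQ.finite_generalizationClasses, ?_⟩
  rintro ⟨Q, hQ⟩
  have hle : ∀ m n, m ≤ n → ConjQuery.Query.Le.{u, v, w} (Q m) (Q n) := fun m n hmn =>
    Nat.le_induction (ConjQuery.Query.Le.refl _) (fun n _ ih => ih.trans (hQ n).1) n hmn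
  -- `Q 0` may be inconsistent, so the finiteness is applied to `Q 1`.
  have hfin := (ConjQuery.Query.consistent_of_lt (hQ 0)).finite_generalizationClasses
  have hmaps : Set.MapsTo
      (fun n => Quotient.mk (ConjQuery.Query.equivalentSetoid.{u, v, w} L) (Q (n + 1)))
      Set.univ (ConjQuery.Query.generalizationClasses.{u, v, w} (Q 1)) :=
    fun n _ => ⟨Q (n + 1), hle 1 (n + 1) (by omega), rfl⟩
  obtain ⟨m, -, n, -, hmn, h⟩ := Set.infinite_univ.exists_lt_map_eq_of_mapsTo hmaps hfin
  have he : ConjQuery.Query.Equivalent.{u, v, w} (Q (m + 1)) (Q (n + 1)) := Quotient.exact h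
  exact (hQ (m + 1)).2 ((hle (m + 2) (n + 1) (by omega)).trans he.2)
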